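/- Let $X$ be a compact (Hausdorff) connected abelian group of finite dimension $d$, that is, its character group $\hat X$ (which is torsion-free) has rank $d$. Let $m$ be the normalized Haar measure of $X$. Every continuous endomorphism $T$ of $X$ induces the endomorphism $\chi\mapsto\chi\circ T$ of $\hat X$, which extends to a linear map $\hat T$ of the $d$-dimensional rational vector space $\mathbb{Q}\otimes\hat X\cong\mathbb{Q}^d$ and, by complexification, of $\mathbb{C}\otimes_{\mathbb{Q}}(\mathbb{Q}\otimes\hat X)\cong\mathbb{C}^d$. Let $T_1,\dots,T_s$ be epimorphisms (continuous surjective endomorphisms) of $X$. They are called mixing if for all sets $B_1,\dots,B_s\subseteq X$ that are measurable with respect to the completion of the Borel $\sigma$-algebra under $m$, $$m\Big(\bigcap_{k=1}^s T_k^{-n}(B_k)\Big)\longrightarrow\prod_{k=1}^s m(B_k)\qquad\text{as } n\to\infty .$$ Theorem. $T_1,\dots,T_s$ are mixing if and only if for every integer $l\ge 1$, every subset $S\subseteq\{1,\dots,s\}$ and every $\lambda\in\mathbb{C}$, there is no family $(w_k)_{k\in S}$ such that each $w_k\in\mathbb{C}^d$ is an eigenvector of $\hat T_k^{\,l}$ with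 eigenvalue $\lambda$ (in particular $w_k\neq 0$) and the family $(w_k)_{k\in S}$ is linearly dependent over $\mathbb{Q}$. -/

import Mathlib

open Filter Topology MeasureTheory
open scoped TensorProduct

universe u

section MixingDefs

variable (X : Type u) [CommGroup X] [TopologicalSpace X]

/-- The character group `X̂` of `X` (continuous homomorphisms from `X` to the circle group),
written additively. -/
abbrev CharGroup : Type u := Additive (PontryaginDual X)

/-- The dimension of a compact connected abelian group `X`: the rank of its character group, i.e.
the maximal number of `ℤ`-linearly independent characters. It is a cardinal number. -/
noncomputable def groupDim [IsTopologicalGroup X] : Cardinal.{u} :=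
  Module.rank ℤ (CharGroup X)

/-- The rational vector space `ℚ ⊗ X̂` spanned by the character group. If `ℤ^d ⊆ X̂ ⊆ ℚ^d`, this
is `ℚ^d`. -/
abbrev RatDual [IsTopologicalGroup X] : Type u := ℚ ⊗[ℤ] CharGroup X

variable {X}

/-- The endomorphism `χ ↦ χ ∘ T` of the character group defined by a continuous endomorphism `T`. -/
noncomputable def charMap [IsTopologicalGroup X] (T : X →ₜ* X) : CharGroup X →ₗ[ℤ] CharGroup X :=
  (MonoidHom.toAdditive (PontryaginDual.map T).toMonoidHom).toIntLinearMap

/-- The linear map `T̂` of the rational vector space `ℚ ⊗ X̂` that extends `χ ↦ χ ∘ T`. -/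
noncomputable def ratDualMap [IsTopologicalGroup X] (T : X →ₜ* X) : Module.End ℚ (RatDual X) :=
  (charMap T).baseChange ℚ

variable (X) in
/-- The Haar measure of the compact group `X`, normalized so that `X` has measure `1`. -/
noncomputable def normalizedHaar [IsTopologicalGroup X] [CompactSpace X]
    [MeasurableSpace X] [BorelSpace X] : Measure X :=
  Measure.haarMeasure ⊤

/-- `T_1, …, T_s` are mixing: for all sets `B_1, …, B_s` that are measurable with respect to the
completion of the Borel `σ`-algebra, the measure of `⋂ k, T_k^{-n} (B_k)` tends to the product of
the measures of the `B_k`. -/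
def IsMixing [IsTopologicalGroup X] [CompactSpace X] [MeasurableSpace X] [BorelSpace X]
    {s : ℕ} (T : Fin s → (X →ₜ* X)) : Prop :=
  ∀ B : Fin s → Set X, (∀ k, NullMeasurableSet (B k) (normalizedHaar X)) →
    Tendsto (fun n : ℕ => normalizedHaar X (⋂ k, (⇑(T k))^[n] ⁻¹' B k)) atTop
      (𝓝 (∏ k, normalizedHaar X (B k)))

end MixingDefs

/-!
Fourier analysis turns mixing into a statement about characters. Integrals of products of characters
along the orbits are `0` or `1`, so `T 1, …, T s` are mixing if and only if, for every nontrivial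
family of characters `χ k`, the relation `∏ k, χ k ∘ T k ^ n = 1` holds for finitely many `n` only
(`isMixing_iff_forall_characters`). One direction tests mixing on preimages of small open sets of
the circle. The other one uses that trigonometric polynomials are dense in `L¹`, which rests on the fact
that characters separate the points of a compact abelian group
(`exists_pontryaginDual_ne_one`). Separation is proved with Gelfand duality: averaging the
translations of `L²(X)` against a continuous function gives an operator `K` for which `x ↦ U x * K`
is norm continuous, and a character `φ` of the commutative C⋆-algebra generated by the translations
`U x` and `K` with `φ ((U x₀ - 1) * K) ≠ 0` restricts to a continuous character `x ↦ φ (U x)` of `X`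
that is nontrivial at `x₀`.

In the vector space `V = ℚ ⊗ X̂` the relation reads `∑ k, A k ^ n (v k) = 0`, where `A k` is the
automorphism of `V` dual to `T k`. If it holds for infinitely many `n`, then the
Skolem–Mahler–Lech theorem (`skolem_mahler_lech`) gives `l ≥ 1` and a nonzero family `u` with
`∑ k, A k ^ (l * n) (u k) = 0` for all `n`. Such families form a rational subspace of `V ^ s`
invariant under the `A k ^ l`, and an eigenvector of its complexification consists of eigenvectors
`w k` of the `A k ^ l`, or zeros, with sum zero. Conversely, a rational relation between
eigenvectors for one eigenvalue persists under the powers of the `A k ^ l`, and contracting it along a `ℚ`-linear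
functional `ℂ → ℚ` and clearing denominators gives characters that satisfy the relation for all
multiples of `l`.

The Skolem–Mahler–Lech theorem is needed over `ℚ` only. For a suitable prime `p` the matrix and
its inverse have `p`-adic integers as entries, so some power of the matrix is close to `1` and is
the exponential of a matrix `L`. The function `z ↦ exp (z • L)` is analytic on the compact set `ℤ_[p]`,
and infinitely many integer zeros accumulate there, which forces the function to vanish on a ball,
hence on an arithmetic progression.
-/

/-! ### Analytic interpolation of powers over the `p`-adic numbers -/

section PadicExp

variable {p : ℕ} [Fact p.Prime]

theorem norm_inv_natCast_factorial_le (n : ℕ) : ‖((n.factorial : ℚ_[p]))⁻¹‖ ≤ (p : ℝ) ^ n := by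
  have hp : 1 ≤ (p : ℝ) := by exact_mod_cast (Fact.out : p.Prime).one_lt.le
  have hn : (n.factorial : ℚ_[p]) ≠ 0 := by exact_mod_cast n.factorial_ne_zero
  rw [norm_inv, Padic.norm_eq_zpow_neg_valuation hn, zpow_neg, inv_inv,
    Padic.valuation_natCast, zpow_natCast]
  refine pow_le_pow_right₀ hp ?_
  have h1 := sub_one_mul_padicValNat_factorial (p := p) n
  have h2 : 1 ≤ p - 1 := by have := (Fact.out : p.Prime).two_le; omega
  calc padicValNat p n.factorial ≤ (p - 1) * padicValNat p n.factorial :=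
        Nat.le_mul_of_pos_left _ h2
    _ ≤ n := by omega

variable {𝔸 : Type*} [NormedRing 𝔸] [NormedAlgebra ℚ_[p] 𝔸]

variable (p 𝔸) in
/-- The `p`-adic exponential series has positive radius of convergence, because
`‖1 / n!‖ ≤ p ^ n`. -/
theorem expSeries_padic_radius_pos : 0 < (NormedSpace.expSeries ℚ_[p] 𝔸).radius := by
  have hp : 0 < (p : ℝ) := by exact_mod_cast (Fact.out : p.Prime).pos
  refine lt_of_lt_of_le ?_ ((NormedSpace.expSeries ℚ_[p] 𝔸).le_radius_of_bound
    (max 1 ‖(1 : 𝔸)‖) (r := (p : NNReal)⁻¹) fun n => ?_)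
  · simp
  · have h1 : ‖ContinuousMultilinearMap.mkPiAlgebraFin ℚ_[p] n 𝔸‖ ≤ max 1 ‖(1 : 𝔸)‖ := by
      rcases Nat.eq_zero_or_pos n with rfl | hn
      · rw [ContinuousMultilinearMap.norm_mkPiAlgebraFin_zero]; exact le_max_right _ _
      · exact (ContinuousMultilinearMap.norm_mkPiAlgebraFin_le_of_pos hn).trans (le_max_left _ _)
    have h2 := norm_inv_natCast_factorial_le (p := p) n
    have h3 : ‖NormedSpace.expSeries ℚ_[p] 𝔸 n‖ ≤ (p : ℝ) ^ n * max 1 ‖(1 : 𝔸)‖ := by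
      refine (ContinuousMultilinearMap.opNorm_smul_le _ _).trans ?_
      gcongr
    calc ‖NormedSpace.expSeries ℚ_[p] 𝔸 n‖ * (((p : NNReal)⁻¹ : NNReal) : ℝ) ^ n
        ≤ ((p : ℝ) ^ n * max 1 ‖(1 : 𝔸)‖) * ((p : ℝ)⁻¹) ^ n := by
          push_cast; gcongr
      _ = max 1 ‖(1 : 𝔸)‖ := by
          rw [inv_pow]; field_simp

/-- Powers of an element close to `1` are interpolated on the closed unit ball of `ℚ_[p]` by the
analytic function `z ↦ exp (z • L)`, where `L` is a logarithm of the element. -/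
theorem eventually_exists_exp_smul_eq_pow [CompleteSpace 𝔸] :
    ∀ᶠ B in 𝓝 (1 : 𝔸), ∃ L : 𝔸,
      (∀ z : ℚ_[p], ‖z‖ ≤ 1 → AnalyticAt ℚ_[p] (fun z : ℚ_[p] => NormedSpace.exp (z • L)) z) ∧
      ∀ n : ℕ, NormedSpace.exp ((n : ℚ_[p]) • L) = B ^ n := by
  have hrad := expSeries_padic_radius_pos p 𝔸
  have hmap : map (NormedSpace.exp : 𝔸 → 𝔸) (𝓝 0) = 𝓝 1 := by
    have h : HasStrictFDerivAt (NormedSpace.exp : 𝔸 → 𝔸)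
        ((ContinuousLinearEquiv.refl ℚ_[p] 𝔸 : 𝔸 ≃L[ℚ_[p]] 𝔸) : 𝔸 →L[ℚ_[p]] 𝔸) 0 :=
      hasStrictFDerivAt_exp_zero_of_radius_pos (𝕂 := ℚ_[p]) hrad
    have := h.map_nhds_eq_of_equiv
    rwa [NormedSpace.exp_zero] at this
  rw [← hmap, eventually_map]
  filter_upwards [Metric.eball_mem_nhds (0 : 𝔸) hrad] with L hL
  have hball : ∀ z : ℚ_[p], ‖z‖ ≤ 1 →
      z • L ∈ Metric.eball (0 : 𝔸) (NormedSpace.expSeries ℚ_[p] 𝔸).radius := by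
    intro z hz
    rw [mem_eball_zero_iff] at hL ⊢
    refine lt_of_le_of_lt ?_ hL
    rw [← ofReal_norm, ← ofReal_norm]
    refine ENNReal.ofReal_le_ofReal ?_
    rw [norm_smul]
    exact mul_le_of_le_one_left (norm_nonneg _) hz
  refine ⟨L, fun z hz => ?_, fun n => ?_⟩
  · have h1 : AnalyticAt ℚ_[p] (NormedSpace.exp : 𝔸 → 𝔸) (z • L) :=
      NormedSpace.analyticAt_exp_of_mem_ball _ (hball z hz)
    have h2 : AnalyticAt ℚ_[p] (fun z : ℚ_[p] => z • L) z := by fun_prop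
    exact AnalyticAt.comp (f := fun z : ℚ_[p] => z • L) h1 h2
  · induction n with
    | zero => simp
    | succ n ih =>
      have hn : ‖(n : ℚ_[p])‖ ≤ 1 := by
        simpa using Padic.norm_int_le_one (p := p) (n : ℤ)
      rw [pow_succ, ← ih, Nat.cast_succ, add_smul, one_smul]
      exact NormedSpace.exp_add_of_commute_of_mem_ball
        ((Commute.refl L).smul_left _) (hball _ hn) hL

/-- A function analytic on the closed unit ball of `ℚ_[p]` with infinitely many zeros in `ℕ`
vanishes on an arithmetic progression: the zeros accumulate in the compact space `ℤ_[p]`. -/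
theorem exists_forall_natCast_add_eq_zero_of_infinite {E : Type*} [NormedAddCommGroup E]
    [NormedSpace ℚ_[p] E] {f : ℚ_[p] → E} (hf : ∀ z : ℚ_[p], ‖z‖ ≤ 1 → AnalyticAt ℚ_[p] f z)
    (hinf : {n : ℕ | f n = 0}.Infinite) :
    ∃ k r : ℕ, ∀ n : ℕ, f ((k + p ^ r * n : ℕ) : ℚ_[p]) = 0 := by
  have hinj : Function.Injective (fun n : ℕ => (n : ℚ_[p])) := Nat.cast_injective
  obtain ⟨z, hz, hacc⟩ := (hinf.image hinj.injOn).exists_accPt_of_subset_isCompact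
    (K := Metric.closedBall (0 : ℚ_[p]) 1) (isCompact_closedBall _ _) (by
      rintro _ ⟨n, -, rfl⟩
      simpa using Padic.norm_int_le_one (p := p) (n : ℤ))
  rw [mem_closedBall_zero_iff] at hz
  rw [accPt_iff_frequently_nhdsNE] at hacc
  have hev : ∀ᶠ w in 𝓝 z, f w = 0 := by
    refine (hf z hz).frequently_zero_iff_eventually_zero.1 (hacc.mono ?_)
    rintro _ ⟨n, hn, rfl⟩
    exact hn
  obtain ⟨ε, hε, hball⟩ := Metric.eventually_nhds_iff.1 hev
  obtain ⟨w, hw, k, -, rfl⟩ := ((hacc.filter_mono nhdsWithin_le_nhds).and_eventually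
    (Metric.ball_mem_nhds z hε)).exists.imp fun w h => And.intro h.2 h.1
  have hp1 : (p : ℝ)⁻¹ < 1 := inv_lt_one_of_one_lt₀ (by
    exact_mod_cast (Fact.out : p.Prime).one_lt)
  obtain ⟨r, hr⟩ := exists_pow_lt_of_lt_one hε hp1
  refine ⟨k, r, fun n => hball ?_⟩
  have h1 : dist ((k + p ^ r * n : ℕ) : ℚ_[p]) (k : ℚ_[p]) < ε := by
    have hn : ‖(n : ℚ_[p])‖ ≤ 1 := by
      simpa using Padic.norm_int_le_one (p := p) (n : ℤ)
    rw [dist_eq_norm]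
    push_cast
    rw [add_sub_cancel_left, norm_mul, norm_pow, Padic.norm_p]
    exact (mul_le_of_le_one_right (by positivity) hn).trans_lt hr
  exact (dist_triangle_max _ (k : ℚ_[p]) z).trans_lt (max_lt h1 hw)

/-- If `B` is close to `1` and a linear map vanishes on infinitely many powers of `B`, then it
vanishes on the powers of `B` along an arithmetic progression. -/
theorem eventually_forall_exists_pow_add_eq_zero [FiniteDimensional ℚ_[p] 𝔸] {E : Type*}
    [NormedAddCommGroup E] [NormedSpace ℚ_[p] E] :
    ∀ᶠ B in 𝓝 (1 : 𝔸), ∀ G : 𝔸 →ₗ[ℚ_[p]] E, {k : ℕ | G (B ^ k) = 0}.Infinite →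
      ∃ k r : ℕ, ∀ n : ℕ, G (B ^ (k + p ^ r * n)) = 0 := by
  have : CompleteSpace 𝔸 := FiniteDimensional.complete ℚ_[p] 𝔸
  filter_upwards [eventually_exists_exp_smul_eq_pow (p := p) (𝔸 := 𝔸)]
  rintro B ⟨L, hL, hLpow⟩ G hinf
  simp only [← hLpow] at hinf ⊢
  exact exists_forall_natCast_add_eq_zero_of_infinite
    (f := fun z : ℚ_[p] => G.toContinuousLinearMap (NormedSpace.exp (z • L)))
    (fun z hz => (G.toContinuousLinearMap.analyticAt _).comp (hL z hz)) hinf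

end PadicExp

/-! ### Zeros of linear recurrences over `ℚ` -/

section SkolemMahlerLech

variable {ι : Type*} [Fintype ι] [DecidableEq ι]

/-- An invertible rational matrix is an invertible matrix of `p`-adic integers for some prime `p`:
take `p` larger than every denominator of the matrix and of its inverse. -/
theorem exists_prime_isUnit_padicInt_matrix {M : Matrix ι ι ℚ} (hM : IsUnit M) :
    ∃ (p : ℕ) (_ : Fact p.Prime) (N : Matrix ι ι ℤ_[p]), IsUnit N ∧
      N.map (algebraMap ℤ_[p] ℚ_[p]) = M.map (algebraMap ℚ ℚ_[p]) := by
  obtain ⟨u, rfl⟩ := hM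
  obtain ⟨p, hpge, hp⟩ := Nat.exists_infinite_primes
    ((∑ i, ∑ j, (u.1 i j).den) + (∑ i, ∑ j, (u⁻¹.1 i j).den) + 1)
  have : Fact p.Prime := ⟨hp⟩
  have hint : ∀ A : Matrix ι ι ℚ, (∑ i, ∑ j, (A i j).den) < p →
      ∃ N : Matrix ι ι ℤ_[p], N.map (algebraMap ℤ_[p] ℚ_[p]) = A.map (algebraMap ℚ ℚ_[p]) := by
    intro A hA
    have hle : ∀ i j, ‖((A i j : ℚ) : ℚ_[p])‖ ≤ 1 := by
      intro i j
      refine Padic.norm_rat_le_one fun hdvd => ?_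
      have h1 : p ≤ (A i j).den := Nat.le_of_dvd (A i j).den_pos hdvd
      have h2 : (A i j).den ≤ ∑ j, (A i j).den :=
        Finset.single_le_sum (f := fun j => (A i j).den) (fun _ _ => Nat.zero_le _)
          (Finset.mem_univ j)
      have h3 : ∑ j, (A i j).den ≤ ∑ i, ∑ j, (A i j).den :=
        Finset.single_le_sum (f := fun i => ∑ j, (A i j).den) (fun _ _ => Nat.zero_le _)
          (Finset.mem_univ i)
      omega
    exact ⟨Matrix.of fun i j => ⟨_, hle i j⟩, by ext i j; rfl⟩
  obtain ⟨N, hN⟩ := hint u.1 (by omega)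
  obtain ⟨N', hN'⟩ := hint u⁻¹.1 (by omega)
  have hinj : Function.Injective
      (fun A : Matrix ι ι ℤ_[p] => A.map (algebraMap ℤ_[p] ℚ_[p])) :=
    Matrix.map_injective (FaithfulSMul.algebraMap_injective _ _)
  refine ⟨p, this, N, IsUnit.of_mul_eq_one N' (hinj ?_), hN⟩
  simp only [Matrix.map_mul, hN, hN']
  rw [← Matrix.map_mul, ← Units.val_mul, mul_inv_cancel, Units.val_one,
    Matrix.map_one _ (map_zero _) (map_one _), Matrix.map_one _ (map_zero _) (map_one _)]

/-- Powers of an invertible matrix of `p`-adic integers return arbitrarily close to `1`, since the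
group of invertible matrices over `ℤ / p ^ r` is finite. -/
theorem exists_pow_mem_of_isUnit_padicInt_matrix {p : ℕ} [Fact p.Prime] {N : Matrix ι ι ℤ_[p]}
    (hN : IsUnit N) {U : Set (Matrix ι ι ℚ_[p])} (hU : U ∈ 𝓝 (1 : Matrix ι ι ℚ_[p])) :
    ∃ l : ℕ, 1 ≤ l ∧ N.map (algebraMap ℤ_[p] ℚ_[p]) ^ l ∈ U := by
  have hpow : ∀ r : ℕ, ∃ l : ℕ, 1 ≤ l ∧
      ∀ i j, ‖(N.map (algebraMap ℤ_[p] ℚ_[p]) ^ l) i j - (1 : Matrix ι ι ℚ_[p]) i j‖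
        ≤ (p : ℝ) ^ (-r : ℤ) := by
    intro r
    have : NeZero (p ^ r) := ⟨pow_ne_zero _ (Fact.out : p.Prime).ne_zero⟩
    obtain ⟨u, hu⟩ := hN.map (PadicInt.toZModPow (p := p) r).mapMatrix
    obtain ⟨l, hl, hul⟩ := isOfFinOrder_iff_pow_eq_one.1 (isOfFinOrder_of_finite u)
    refine ⟨l, hl, fun i j => ?_⟩
    have h1 : (PadicInt.toZModPow (p := p) r).mapMatrix (N ^ l - 1) = 0 := by
      rw [map_sub, map_pow, map_one, ← hu, ← Units.val_pow_eq_pow_val, hul, Units.val_one,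
        sub_self]
    have h2 : (N ^ l - 1) i j ∈ RingHom.ker (PadicInt.toZModPow (p := p) r) := by
      rw [RingHom.mem_ker]
      exact congrFun (congrFun h1 i) j
    rw [PadicInt.ker_toZModPow, ← PadicInt.norm_le_pow_iff_mem_span_pow] at h2
    have h3 : (N.map (algebraMap ℤ_[p] ℚ_[p]) ^ l) - 1
        = (N ^ l - 1).map (algebraMap ℤ_[p] ℚ_[p]) := by
      have := map_sub (algebraMap ℤ_[p] ℚ_[p]).mapMatrix (N ^ l) 1
      rw [map_pow, map_one] at this
      exact this.symm
    rw [← Matrix.sub_apply, h3]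
    exact h2
  choose l hl1 hl using hpow
  have hp0 : (0 : ℝ) ≤ (p : ℝ)⁻¹ := by positivity
  have hp1 : (p : ℝ)⁻¹ < 1 := inv_lt_one_of_one_lt₀ (by
    exact_mod_cast (Fact.out : p.Prime).one_lt)
  have hlim : Tendsto (fun r => N.map (algebraMap ℤ_[p] ℚ_[p]) ^ l r) atTop (𝓝 1) := by
    refine tendsto_pi_nhds.2 fun i => tendsto_pi_nhds.2 fun j => ?_
    rw [tendsto_iff_norm_sub_tendsto_zero]
    refine squeeze_zero (fun _ => norm_nonneg _) (fun r => hl r i j) ?_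
    simpa [zpow_neg, ← inv_pow] using tendsto_pow_atTop_nhds_zero_of_lt_one hp0 hp1
  obtain ⟨r, hr⟩ := (hlim.eventually hU).exists
  exact ⟨l r, hl1 r, hr⟩

open scoped Matrix.Norms.Operator in
theorem skolem_mahler_lech_matrix {κ : Type*} [Fintype κ] {M : Matrix ι ι ℚ} (hM : IsUnit M)
    (C : Matrix κ ι ℚ) (v : ι → ℚ)
    (hinf : {n : ℕ | C.mulVec ((M ^ n).mulVec v) = 0}.Infinite) :
    ∃ a l : ℕ, 1 ≤ l ∧ ∀ n : ℕ, C.mulVec ((M ^ (a + l * n)).mulVec v) = 0 := by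
  obtain ⟨p, _, N, hN, hNM⟩ := exists_prime_isUnit_padicInt_matrix hM
  set P : Matrix ι ι ℚ_[p] := M.map (algebraMap ℚ ℚ_[p]) with hP
  obtain ⟨l, hl, hPl⟩ := exists_pow_mem_of_isUnit_padicInt_matrix hN
    (eventually_forall_exists_pow_add_eq_zero (p := p) (𝔸 := Matrix ι ι ℚ_[p])
      (E := κ → ℚ_[p]))
  rw [hNM] at hPl
  -- A residue class modulo `l` contains infinitely many of the zeros.
  obtain ⟨a, ha⟩ : ∃ a : ℕ, {k : ℕ | C.mulVec ((M ^ (a + l * k)).mulVec v) = 0}.Infinite := by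
    by_contra! hfin
    refine hinf (((Set.finite_lt_nat l).biUnion
      (fun a _ => (hfin a).image (fun k => a + l * k))).subset fun n hn => ?_)
    refine Set.mem_biUnion (x := n % l) (Nat.mod_lt _ hl) ⟨n / l, ?_, Nat.mod_add_div n l⟩
    simpa [Nat.mod_add_div] using hn
  let G : Matrix ι ι ℚ_[p] →ₗ[ℚ_[p]] (κ → ℚ_[p]) :=
    { toFun := fun B => (C.map (algebraMap ℚ ℚ_[p])).mulVec
        ((P ^ a * B).mulVec (algebraMap ℚ ℚ_[p] ∘ v))
      map_add' := fun B B' => by rw [mul_add, Matrix.add_mulVec, Matrix.mulVec_add]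
      map_smul' := fun c B => by
        rw [mul_smul_comm, Matrix.smul_mulVec, Matrix.mulVec_smul, RingHom.id_apply] }
  have hG : ∀ k : ℕ, G ((P ^ l) ^ k) =
      algebraMap ℚ ℚ_[p] ∘ (C.mulVec ((M ^ (a + l * k)).mulVec v)) := by
    intro k
    have h1 : P ^ a * (P ^ l) ^ k = (M ^ (a + l * k)).map (algebraMap ℚ ℚ_[p]) := by
      rw [← pow_mul, ← pow_add]
      exact (map_pow (algebraMap ℚ ℚ_[p]).mapMatrix M _).symm
    change (C.map (algebraMap ℚ ℚ_[p])).mulVec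
        ((P ^ a * (P ^ l) ^ k).mulVec (algebraMap ℚ ℚ_[p] ∘ v)) = _
    rw [h1]
    ext i
    rw [Function.comp_apply, RingHom.map_mulVec]
    congr 2
    ext j
    rw [Function.comp_apply, RingHom.map_mulVec]
  have hG0 : ∀ k : ℕ, G ((P ^ l) ^ k) = 0 ↔
      C.mulVec ((M ^ (a + l * k)).mulVec v) = 0 := by
    intro k
    rw [hG]
    simp only [funext_iff, Function.comp_apply, Pi.zero_apply,
      map_eq_zero_iff _ (algebraMap ℚ ℚ_[p]).injective]
  obtain ⟨k, r, hk⟩ := hPl G (by simpa only [hG0] using ha)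
  refine ⟨a + l * k, l * p ^ r, Nat.mul_pos hl (pow_pos (Fact.out : p.Prime).pos _),
    fun n => ?_⟩
  have := (hG0 _).1 (hk n)
  rwa [show a + l * (k + p ^ r * n) = a + l * k + l * p ^ r * n by ring] at this

/-- The Skolem–Mahler–Lech theorem for an invertible rational matrix, in coordinate-free form: if
`φ (A ^ n v) = 0` for infinitely many `n`, then `φ (A ^ n v) = 0` along an arithmetic
progression. -/
theorem skolem_mahler_lech {V W : Type*} [AddCommGroup V] [Module ℚ V] [FiniteDimensional ℚ V]
    [AddCommGroup W] [Module ℚ W] [FiniteDimensional ℚ W] {A : Module.End ℚ V} (hA : IsUnit A)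
    (φ : V →ₗ[ℚ] W) (v : V) (hinf : {n : ℕ | φ ((A ^ n) v) = 0}.Infinite) :
    ∃ a l : ℕ, 1 ≤ l ∧ ∀ n : ℕ, φ ((A ^ (a + l * n)) v) = 0 := by
  let b := Module.finBasis ℚ V
  let c := Module.finBasis ℚ W
  have key : ∀ n, (LinearMap.toMatrix b c φ).mulVec
      ((LinearMap.toMatrixAlgEquiv b A ^ n).mulVec (b.repr v)) = 0 ↔ φ ((A ^ n) v) = 0 := by
    intro n
    have h1 : (LinearMap.toMatrixAlgEquiv b A ^ n).mulVec (b.repr v) = b.repr ((A ^ n) v) := by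
      rw [← map_pow]
      exact LinearMap.toMatrix_mulVec_repr b b (A ^ n) v
    rw [h1, LinearMap.toMatrix_mulVec_repr]
    simp
  simp only [← key] at hinf ⊢
  exact skolem_mahler_lech_matrix (hA.map (LinearMap.toMatrixAlgEquiv b)) _ _ hinf

end SkolemMahlerLech

/-! ### Characters separate the points of a compact abelian group -/

section Separation

/-- Gelfand duality: the nonzero elements of a closed commutative star subalgebra of a C⋆-algebra
are detected by characters. -/
theorem StarSubalgebra.exists_starAlgHom_apply_ne_zero {A : Type*} [CStarAlgebra A]
    (B : StarSubalgebra ℂ A) (hclosed : IsClosed (B : Set A)) (hcomm : ∀ x y : B, x * y = y * x)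
    (a : B) (ha : a ≠ 0) : ∃ φ : B →⋆ₐ[ℂ] ℂ, Continuous φ ∧ φ a ≠ 0 := by
  let : CommCStarAlgebra B :=
    { StarSubalgebra.cstarAlgebra B (h_closed := hclosed) with mul_comm := hcomm }
  have h : WeakDual.gelfandTransform ℂ B a ≠ 0 := fun h0 =>
    ha ((gelfandTransform_isometry B).injective (h0.trans (map_zero _).symm))
  obtain ⟨φ, hφ⟩ := DFunLike.ne_iff.1 h
  exact ⟨{ toFun := φ, map_one' := map_one φ, map_mul' := map_mul φ, map_zero' := map_zero φ,
           map_add' := map_add φ, commutes' := AlgHomClass.commutes φ,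
           map_star' := map_star φ }, map_continuous φ, hφ⟩

variable {X : Type*} [CommGroup X] [TopologicalSpace X] [IsTopologicalGroup X] [CompactSpace X]
  [MeasurableSpace X] [BorelSpace X]
  {H : Type*} [NormedAddCommGroup H] [InnerProductSpace ℂ H] [CompleteSpace H]

open scoped InnerProductSpace

/-- The operator `∫ f y • U y` attached to a continuous function `f` and a strongly continuous
isometric representation `U`. -/
noncomputable def averagingOperator (μ : Measure X) [IsProbabilityMeasure μ]
    (U : X →* (H →L[ℂ] H)) (hU : ∀ g, Continuous fun x => U x g) (hnorm : ∀ x g, ‖U x g‖ = ‖g‖) :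
    C(X, ℂ) →L[ℂ] H →L[ℂ] H :=
  have hint : ∀ (f : C(X, ℂ)) (g : H), Integrable (fun y => f y • U y g) μ := fun f g =>
    (f.continuous.smul (hU g)).integrable_of_hasCompactSupport
      (HasCompactSupport.of_compactSpace _)
  LinearMap.mkContinuous₂
    (LinearMap.mk₂ ℂ (fun (f : C(X, ℂ)) g => ∫ y, f y • U y g ∂μ)
      (fun f f' g => by
        simp only [ContinuousMap.add_apply, add_smul]
        exact integral_add (hint f g) (hint f' g))
      (fun c f g => by
        simp only [ContinuousMap.smul_apply, smul_assoc]
        exact integral_smul c _)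
      (fun f g g' => by
        simp only [map_add, smul_add]
        exact integral_add (hint f g) (hint f g'))
      (fun c f g => by
        simp only [map_smul, smul_comm _ c]
        exact integral_smul c _))
    1 (fun f g => by
      refine (norm_integral_le_of_norm_le_const (C := ‖f‖ * ‖g‖) (.of_forall fun y => ?_)).trans ?_
      · rw [norm_smul, hnorm]
        gcongr
        exact f.norm_coe_le_norm y
      · simp)

section Averaging

variable (μ : Measure X) [IsProbabilityMeasure μ] (U : X →* (H →L[ℂ] H))
  (hU : ∀ g, Continuous fun x => U x g) (hnorm : ∀ x g, ‖U x g‖ = ‖g‖)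

omit [IsTopologicalGroup X] [CompleteSpace H] in
theorem averagingOperator_apply (f : C(X, ℂ)) (g : H) :
    averagingOperator μ U hU hnorm f g = ∫ y, f y • U y g ∂μ := rfl

omit [IsTopologicalGroup X] in
theorem commute_averagingOperator {S : H →L[ℂ] H} (hS : ∀ x, S * U x = U x * S) (f : C(X, ℂ)) :
    S * averagingOperator μ U hU hnorm f = averagingOperator μ U hU hnorm f * S := by
  ext g
  rw [mul_apply_eq_comp, mul_apply_eq_comp, averagingOperator_apply,
    averagingOperator_apply, ← ContinuousLinearMap.integral_comp_comm]
  · refine integral_congr_ae (.of_forall fun y => ?_)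
    have := congrArg (fun A : H →L[ℂ] H => A g) (hS y)
    simp only [mul_apply_eq_comp] at this
    simp only [map_smul, this]
  · exact (f.continuous.smul (hU g)).integrable_of_hasCompactSupport
      (HasCompactSupport.of_compactSpace _)

theorem mul_averagingOperator [μ.IsMulLeftInvariant] (x : X) (f : C(X, ℂ)) :
    U x * averagingOperator μ U hU hnorm f =
      averagingOperator μ U hU hnorm (f.comp ⟨fun y => x⁻¹ * y, by fun_prop⟩) := by
  ext g
  rw [mul_apply_eq_comp, averagingOperator_apply,
    averagingOperator_apply, ← ContinuousLinearMap.integral_comp_comm]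
  · rw [← integral_mul_left_eq_self (fun y => _ • U y g) x]
    refine integral_congr_ae (.of_forall fun y => ?_)
    simp [map_mul]
  · exact (f.continuous.smul (hU g)).integrable_of_hasCompactSupport
      (HasCompactSupport.of_compactSpace _)

/-- Averaging turns the strongly continuous representation into a norm continuous one. -/
theorem continuous_mul_averagingOperator [μ.IsMulLeftInvariant] (f : C(X, ℂ)) :
    Continuous fun x => U x * averagingOperator μ U hU hnorm f := by
  simp only [mul_averagingOperator]
  refine (averagingOperator μ U hU hnorm).continuous.comp ?_
  let F : C(X × X, ℂ) := ⟨fun q => f (q.1⁻¹ * q.2), by fun_prop⟩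
  exact F.curry.continuous

omit [IsTopologicalGroup X] in
/-- If `U x₀ ≠ 1`, then `(U x₀ - 1) * ∫ f y • U y ≠ 0` for some `f`. If `h y = (U x₀ - 1) (U y g)`
is nonzero at `1`, then `f y = ⟪h y, h 1⟫` works, because the integral has positive inner product
with `h 1`. -/
theorem exists_mul_averagingOperator_ne [μ.IsOpenPosMeasure] {x₀ : X} (hx₀ : U x₀ ≠ 1) :
    ∃ f : C(X, ℂ), (U x₀ - 1) * averagingOperator μ U hU hnorm f ≠ 0 := by
  obtain ⟨g, hg⟩ := DFunLike.ne_iff.1 hx₀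
  set h : X → H := fun y => (U x₀ - 1) (U y g) with hdef
  have hcont : Continuous h := (U x₀ - 1).continuous.comp (hU g)
  have h1 : h 1 ≠ 0 := by
    simpa [hdef, sub_eq_zero] using hg
  let f : C(X, ℂ) := ⟨fun y => ⟪h y, h 1⟫_ℂ, by fun_prop⟩
  have hI : Integrable (fun y => f y • U y g) μ :=
    (f.continuous.smul (hU g)).integrable_of_hasCompactSupport (HasCompactSupport.of_compactSpace _)
  have hI' : Integrable (fun y => f y • h y) μ :=
    (f.continuous.smul hcont).integrable_of_hasCompactSupport (HasCompactSupport.of_compactSpace _)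
  refine ⟨f, fun h0 => ?_⟩
  have h2 : ∫ y, f y • h y ∂μ = 0 := by
    have := congrArg (fun A : H →L[ℂ] H => A g) h0
    simp only [mul_apply_eq_comp, averagingOperator_apply] at this
    rw [← ContinuousLinearMap.integral_comp_comm _ hI] at this
    simpa only [map_smul, zero_apply] using this
  have h3 : ∫ y, ‖f y‖ ^ 2 ∂μ = 0 := by
    have h4 := congrArg (fun v => ⟪h 1, v⟫_ℂ) h2
    simp only [inner_zero_right] at h4
    rw [← integral_inner hI'] at h4
    have h5 : ∀ y, ⟪h 1, f y • h y⟫_ℂ = ((‖f y‖ ^ 2 : ℝ) : ℂ) := by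
      intro y
      rw [inner_smul_right, ← inner_conj_symm (h 1) (h y), Complex.ofReal_pow]
      exact Complex.mul_conj' (f y)
    simp only [h5] at h4
    rw [integral_complex_ofReal] at h4
    exact_mod_cast h4
  have hc : Continuous fun y => ‖f y‖ ^ 2 := by fun_prop
  have h6 : (fun y => ‖f y‖ ^ 2) = fun _ => (0 : ℝ) :=
    Measure.eq_of_ae_eq ((integral_eq_zero_iff_of_nonneg (fun y => by positivity)
      (hc.integrable_of_hasCompactSupport (HasCompactSupport.of_compactSpace _))).1 h3)
      hc continuous_const
  have h7 := congrFun h6 1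
  have h8 : ⟪h 1, h 1⟫_ℂ = 0 := by simpa [f] using h7
  exact h1 (inner_self_eq_zero.1 h8)

end Averaging

/-- A strongly continuous unitary representation of a compact abelian group that does not kill `x₀`
yields a character that is nontrivial at `x₀`: compose the representation with a suitable character
of the commutative C⋆-algebra generated by the representation and an averaging operator. -/
theorem exists_continuousMonoidHom_ne_one_of_representation (μ : Measure X)
    [IsProbabilityMeasure μ] [μ.IsMulLeftInvariant] [μ.IsOpenPosMeasure] (U : X →* (H →L[ℂ] H))
    (hU : ∀ g, Continuous fun x => U x g) (hstar : ∀ x, star (U x) = U x⁻¹) {x₀ : X}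
    (hx₀ : U x₀ ≠ 1) : ∃ χ : X →ₜ* Circle, χ x₀ ≠ 1 := by
  have hnorm : ∀ x g, ‖U x g‖ = ‖g‖ := by
    intro x g
    have h1 : ⟪U x g, U x g⟫_ℂ = ⟪g, g⟫_ℂ := by
      rw [← ContinuousLinearMap.adjoint_inner_right, ← ContinuousLinearMap.star_eq_adjoint, hstar,
        ← mul_apply_eq_comp, ← map_mul]
      simp
    rw [inner_self_eq_norm_sq_to_K, inner_self_eq_norm_sq_to_K] at h1
    have h2 : ‖U x g‖ ^ 2 = ‖g‖ ^ 2 := by exact_mod_cast h1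
    exact (pow_left_inj₀ (norm_nonneg _) (norm_nonneg _) two_ne_zero).1 h2
  obtain ⟨f, hf⟩ := exists_mul_averagingOperator_ne μ U hU hnorm hx₀
  set K := averagingOperator μ U hU hnorm f with hK
  have hUU : ∀ x y, U x * U y = U y * U x := fun x y => by rw [← map_mul, mul_comm, map_mul]
  have hUK : ∀ x, U x * K = K * U x := fun x => commute_averagingOperator μ U hU hnorm (hUU x) f
  have hKU : ∀ x, star K * U x = U x * star K := by
    intro x
    have := congrArg star (hUK x⁻¹)
    rwa [star_mul, star_mul, hstar, inv_inv] at this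
  have hKK : star K * K = K * star K := commute_averagingOperator μ U hU hnorm hKU f
  let s : Set (H →L[ℂ] H) := insert K (Set.range U)
  have h₁ : ∀ a ∈ s, ∀ b ∈ s, a * b = b * a := by
    rintro a (rfl | ⟨x, rfl⟩) b (rfl | ⟨y, rfl⟩)
    exacts [rfl, (hUK y).symm, hUK x, hUU x y]
  have h₂ : ∀ a ∈ s, ∀ b ∈ s, a * star b = star b * a := by
    rintro a (rfl | ⟨x, rfl⟩) b (rfl | ⟨y, rfl⟩)
    · exact hKK.symm
    · rw [hstar, hUK]
    · exact (hKU x).symm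
    · rw [hstar, hUU]
  have hmem : ∀ a ∈ s, a ∈ (StarAlgebra.adjoin ℂ s).topologicalClosure := fun a ha =>
    StarSubalgebra.le_topologicalClosure _ (StarAlgebra.subset_adjoin ℂ s ha)
  let K' : (StarAlgebra.adjoin ℂ s).topologicalClosure := ⟨K, hmem _ (Or.inl rfl)⟩
  let U' : X →* (StarAlgebra.adjoin ℂ s).topologicalClosure :=
    U.codRestrict _ fun x => hmem _ (Or.inr ⟨x, rfl⟩)
  obtain ⟨φ, hφ, hφa⟩ := StarSubalgebra.exists_starAlgHom_apply_ne_zero _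
    (StarSubalgebra.isClosed_topologicalClosure _)
    (StarSubalgebra.commRingTopologicalClosure _
      (StarAlgebra.isMulCommutative_adjoin ℂ h₁ h₂).is_comm.comm).mul_comm
    ((U' x₀ - 1) * K') (fun h0 => hf (congrArg Subtype.val h0))
  rw [map_mul, map_sub, map_one] at hφa
  have hφK : φ K' ≠ 0 := right_ne_zero_of_mul hφa
  have hφU : φ (U' x₀) ≠ 1 := sub_ne_zero.1 (left_ne_zero_of_mul hφa)
  have hunit : ∀ x, φ (U' x) ∈ Submonoid.unitSphere ℂ := by
    intro x
    have h1 : star (U' x) * U' x = 1 := by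
      refine Subtype.ext ?_
      change star (U x) * U x = 1
      rw [hstar, ← map_mul, inv_mul_cancel, map_one]
    have h2 := congrArg φ h1
    rw [map_mul, map_star, map_one] at h2
    have h3 : ‖φ (U' x)‖ * ‖φ (U' x)‖ = 1 := by
      have := congrArg norm h2
      rwa [norm_mul, norm_star, norm_one] at this
    refine mem_sphere_zero_iff_norm.2 ?_
    nlinarith [norm_nonneg (φ (U' x))]
  let χ : X →* Circle := ((φ : _ →* ℂ).comp U').codRestrict (Submonoid.unitSphere ℂ) hunit
  have hχ : Continuous χ := by
    refine Continuous.subtype_mk (f := fun x => φ (U' x)) ?_ hunit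
    have h1 : (fun x => φ (U' x)) = fun x => φ (U' x * K') / φ K' := by
      ext x
      rw [map_mul, mul_div_cancel_right₀ _ hφK]
    rw [h1]
    refine (hφ.comp ?_).div_const _
    exact (continuous_mul_averagingOperator μ U hU hnorm f).subtype_mk _
  exact ⟨⟨χ, hχ⟩, fun h => hφU (congrArg (fun z : Circle => (z : ℂ)) h)⟩

end Separation

section HaarCharacters

variable {X : Type u} [CommGroup X] [TopologicalSpace X] [IsTopologicalGroup X] [CompactSpace X]
  [MeasurableSpace X] [BorelSpace X]

instance : (normalizedHaar X).IsHaarMeasure := Measure.isHaarMeasure_haarMeasure _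

instance : (normalizedHaar X).Regular := Measure.regular_haarMeasure

instance : IsProbabilityMeasure (normalizedHaar X) := ⟨Measure.haarMeasure_self⟩

variable (X) in
/-- The representation of `X` by translations on `L²(X)`. -/
noncomputable def translationRep :
    X →* (Lp ℂ 2 (normalizedHaar X) →L[ℂ] Lp ℂ 2 (normalizedHaar X)) where
  toFun x := LinearIsometry.toContinuousLinearMap
    { toFun := fun g => DomMulAct.mk x • g
      map_add' := smul_add _
      map_smul' := fun c g => smul_comm _ c g
      norm_map' := DomMulAct.norm_smul_Lp _ }
  map_one' := by
    ext1 g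
    change (1 : Xᵈᵐᵃ) • g = g
    rw [one_smul]
  map_mul' x y := by
    ext1 g
    change DomMulAct.mk (x * y) • g = DomMulAct.mk x • DomMulAct.mk y • g
    rw [mul_comm, DomMulAct.mk_mul, mul_smul]

theorem translationRep_apply (x : X) (g : Lp ℂ 2 (normalizedHaar X)) :
    translationRep X x g = DomMulAct.mk x • g := rfl

theorem star_translationRep (x : X) : star (translationRep X x) = translationRep X x⁻¹ := by
  rw [ContinuousLinearMap.star_eq_adjoint, eq_comm, ContinuousLinearMap.eq_adjoint_iff]
  intro g h
  have hg : translationRep X x (translationRep X x⁻¹ g) = g := by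
    rw [← mul_apply_eq_comp, ← map_mul, mul_inv_cancel, map_one, one_apply_eq_self]
  conv_rhs => rw [← hg]
  let I : Lp ℂ 2 (normalizedHaar X) →ₗᵢ[ℂ] Lp ℂ 2 (normalizedHaar X) :=
    { (translationRep X x).toLinearMap with norm_map' := DomMulAct.norm_smul_Lp _ }
  exact (I.inner_map_map _ _).symm

theorem translationRep_ne_one [T2Space X] {x₀ : X} (hx₀ : x₀ ≠ 1) : translationRep X x₀ ≠ 1 := by
  intro h
  obtain ⟨F, hF1, hF0, -⟩ := exists_continuous_zero_one_of_isClosed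
    (isClosed_singleton (x := (1 : X))) (isClosed_singleton (x := x₀))
    (Set.disjoint_singleton.2 hx₀.symm)
  have hc : Continuous fun x => (F x : ℂ) := by fun_prop
  have hmem : MemLp (fun x => (F x : ℂ)) 2 (normalizedHaar X) :=
    hc.memLp_of_hasCompactSupport (HasCompactSupport.of_compactSpace _)
  have h1 := congrArg (fun A : _ →L[ℂ] _ => A (hmem.toLp _)) h
  simp only [translationRep_apply, one_apply_eq_self, DomMulAct.mk_smul_toLp] at h1
  rw [MemLp.toLp_eq_toLp_iff] at h1
  have h2 := Measure.eq_of_ae_eq h1 (by fun_prop) hc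
  have h3 := congrFun h2 1
  simp only [smul_eq_mul, mul_one] at h3
  rw [hF1 rfl, hF0 rfl] at h3
  simp at h3

/-- The characters of a compact Hausdorff abelian group separate its points. -/
theorem exists_pontryaginDual_ne_one [T2Space X] {x₀ : X} (hx₀ : x₀ ≠ 1) :
    ∃ χ : PontryaginDual X, χ x₀ ≠ 1 := by
  have : Fact ((2 : ENNReal) ≠ ⊤) := ⟨by simp⟩
  exact exists_continuousMonoidHom_ne_one_of_representation (normalizedHaar X) (translationRep X)
    (fun g => (DomMulAct.continuous_mk.smul continuous_const :
      Continuous fun x : X => DomMulAct.mk x • g)) star_translationRep (translationRep_ne_one hx₀)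

end HaarCharacters

/-! ### Trigonometric polynomials -/

section TrigonometricPolynomials

variable {X : Type u} [CommGroup X] [TopologicalSpace X]

variable (X) in
/-- A character viewed as a continuous complex-valued function. -/
noncomputable def characterToContinuousMap : PontryaginDual X →* C(X, ℂ) where
  toFun χ := ⟨fun x => (χ x : ℂ), continuous_subtype_val.comp (map_continuous χ)⟩
  map_one' := rfl
  map_mul' _ _ := rfl

@[simp]
theorem characterToContinuousMap_apply (χ : PontryaginDual X) (x : X) :
    characterToContinuousMap X χ x = χ x := rfl

/-- By the Stone–Weierstrass theorem, trigonometric polynomials are uniformly dense in `C(X)`. -/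
theorem topologicalClosure_span_characters [IsTopologicalGroup X] [CompactSpace X] [T2Space X] :
    (Submodule.span ℂ (Set.range (characterToContinuousMap X))).topologicalClosure = ⊤ := by
  borelize X
  let A : StarSubalgebra ℂ C(X, ℂ) :=
    { Algebra.adjoin ℂ (Set.range (characterToContinuousMap X)) with
      star_mem' := by
        intro a ha
        induction ha using Algebra.adjoin_induction with
        | mem a ha =>
          obtain ⟨χ, rfl⟩ := ha
          refine Algebra.subset_adjoin ⟨χ⁻¹, ?_⟩
          ext x
          exact Circle.coe_inv_eq_conj (χ x)
        | algebraMap r => exact Subalgebra.algebraMap_mem _ (star r)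
        | add a b _ _ ha hb => rw [star_add]; exact Subalgebra.add_mem _ ha hb
        | mul a b _ _ ha hb => rw [star_mul]; exact Subalgebra.mul_mem _ hb ha }
  have hsep : A.SeparatesPoints := by
    intro x y hxy
    obtain ⟨χ, hχ⟩ := exists_pontryaginDual_ne_one (div_ne_one.2 hxy)
    refine ⟨_, ⟨characterToContinuousMap X χ, Algebra.subset_adjoin ⟨χ, rfl⟩, rfl⟩, fun h => hχ ?_⟩
    rw [map_div, div_eq_one]
    exact Circle.coe_injective h
  have hspan : (Submodule.span ℂ (Set.range (characterToContinuousMap X)) : Set C(X, ℂ)) = A := by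
    change _ = (Algebra.adjoin ℂ (Set.range (characterToContinuousMap X)) : Set C(X, ℂ))
    rw [← Subalgebra.coe_toSubmodule, Algebra.adjoin_eq_span, ← MonoidHom.coe_mrange,
      Submonoid.closure_eq]
  have h := ContinuousMap.starSubalgebra_topologicalClosure_eq_top_of_separatesPoints A hsep
  rw [← SetLike.coe_set_eq, Submodule.topologicalClosure_coe, hspan,
    ← StarSubalgebra.topologicalClosure_coe, h]
  rfl

/-- Trigonometric polynomials are dense in `L¹`. -/
theorem exists_mem_span_characters_integral_norm_sub_le [IsTopologicalGroup X] [CompactSpace X]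
    [T2Space X] [MeasurableSpace X] [BorelSpace X] {g : X → ℂ}
    (hg : Integrable g (normalizedHaar X)) {ε : ℝ} (hε : 0 < ε) :
    ∃ t ∈ Submodule.span ℂ (Set.range (characterToContinuousMap X)),
      ∫ x, ‖g x - t x‖ ∂(normalizedHaar X) ≤ ε := by
  obtain ⟨f, hf, hfi⟩ := hg.exists_boundedContinuous_integral_sub_le (half_pos hε)
  have hdense : f.toContinuousMap ∈
      closure (Submodule.span ℂ (Set.range (characterToContinuousMap X)) : Set C(X, ℂ)) := by
    rw [← Submodule.topologicalClosure_coe, topologicalClosure_span_characters]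
    trivial
  obtain ⟨t, ht, hft⟩ := Metric.mem_closure_iff.1 hdense (ε / 2) (half_pos hε)
  have hti : Integrable t (normalizedHaar X) :=
    t.continuous.integrable_of_hasCompactSupport (HasCompactSupport.of_compactSpace _)
  refine ⟨t, ht, ?_⟩
  have h1 : ∀ x, ‖g x - t x‖ ≤ ‖g x - f x‖ + ε / 2 := by
    intro x
    have h2 : ‖f x - t x‖ ≤ ε / 2 := by
      rw [← dist_eq_norm]
      exact (ContinuousMap.dist_apply_le_dist (f := f.toContinuousMap) (g := t) x).trans hft.le
    calc ‖g x - t x‖ = ‖(g x - f x) + (f x - t x)‖ := by rw [sub_add_sub_cancel]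
      _ ≤ _ := (norm_add_le _ _).trans (by gcongr)
  calc ∫ x, ‖g x - t x‖ ∂(normalizedHaar X)
      ≤ ∫ x, (‖g x - f x‖ + ε / 2) ∂(normalizedHaar X) :=
        integral_mono (hg.sub hti).norm ((hg.sub hfi).norm.add (integrable_const _)) h1
    _ = ∫ x, ‖g x - f x‖ ∂(normalizedHaar X) + ε / 2 := by
        have h3 := integral_add (hg.sub hfi).norm
          (integrable_const (μ := normalizedHaar X) (ε / 2))
        simpa using h3
    _ ≤ ε := by linarith

end TrigonometricPolynomials

/-! ### Mixing in terms of characters -/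

section Mixing

variable {X : Type u} [CommGroup X] [TopologicalSpace X] [IsTopologicalGroup X] [CompactSpace X]
  [MeasurableSpace X] [BorelSpace X]

theorem integral_character_eq_zero {χ : PontryaginDual X} (hχ : ∃ x, χ x ≠ 1) :
    ∫ x, (χ x : ℂ) ∂(normalizedHaar X) = 0 := by
  obtain ⟨a, ha⟩ := hχ
  have h1 := integral_mul_left_eq_self (μ := normalizedHaar X) (fun x => (χ x : ℂ)) a
  simp only [map_mul, Circle.coe_mul] at h1
  rw [integral_const_mul] at h1
  have h2 : ((χ a : ℂ) - 1) * ∫ x, (χ x : ℂ) ∂(normalizedHaar X) = 0 := by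
    rw [sub_mul, h1, one_mul, sub_self]
  refine (mul_eq_zero.1 h2).resolve_left fun h => ha ?_
  exact Circle.coe_injective (sub_eq_zero.1 h)

variable {s : ℕ} {T : Fin s → (X →ₜ* X)}

omit [IsTopologicalGroup X] [CompactSpace X] [BorelSpace X] [MeasurableSpace X] in
/-- The product of the characters `χ k` evaluated along the orbits is again a character. -/
theorem exists_pontryaginDual_eq_prod_iterate (T : Fin s → (X →ₜ* X))
    (χ : Fin s → PontryaginDual X) (n : ℕ) :
    ∃ ψ : PontryaginDual X, ∀ x, ψ x = ∏ k, χ k ((T k)^[n] x) := by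
  refine ⟨(⟨⟨⟨fun x => ∏ k, χ k ((T k)^[n] x), ?_⟩, ?_⟩, ?_⟩ : X →ₜ* Circle), fun x => rfl⟩
  · simp [iterate_map_one]
  · intro x y
    simp [iterate_map_mul, Finset.prod_mul_distrib]
  · exact continuous_finsetProd Finset.univ fun k _ =>
      (map_continuous (χ k)).comp ((map_continuous (T k)).iterate n)

/-- If the `T k` are mixing, then a nontrivial relation between the characters `χ k` along the
orbits holds only finitely often. Otherwise take for `B k` the points whose value under `χ k` is
close to `1`, or close to a nontrivial value of `χ k` for one index `k`: these are open sets whose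
preimages have empty intersection whenever the relation holds. -/
theorem IsMixing.eventually_exists_prod_iterate_ne_one (h : IsMixing T)
    {χ : Fin s → PontryaginDual X} (hχ : χ ≠ 1) :
    ∀ᶠ n in atTop, ∃ x, ∏ k, χ k ((T k)^[n] x) ≠ 1 := by
  obtain ⟨k₀, hk₀⟩ := Function.ne_iff.1 hχ
  obtain ⟨x₀, hx₀⟩ : ∃ x, χ k₀ x ≠ 1 := by
    by_contra! hall
    exact hk₀ (PontryaginDual.ext hall)
  let y : Fin s → X := Pi.mulSingle k₀ x₀
  let u : Fin s → Circle := fun k => χ k (y k)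
  have hu : ∏ k, u k ≠ 1 := by
    rw [Finset.prod_eq_single k₀ (fun k _ hk => by simp [u, y, hk]) (by simp)]
    simpa [u, y] using hx₀
  have hnhds : {w : Fin s → Circle | ∏ k, w k ≠ 1} ∈ 𝓝 u :=
    (isOpen_ne.preimage (continuous_finsetProd _ fun k _ => continuous_apply k)).mem_nhds hu
  rw [nhds_pi, Filter.mem_pi'] at hnhds
  obtain ⟨I, W, hW, hsub⟩ := hnhds
  let B : Fin s → Set X := fun k => χ k ⁻¹' interior (W k)
  have hopen : ∀ k, IsOpen (B k) := fun k => isOpen_interior.preimage (map_continuous (χ k))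
  have hpos : 0 < ∏ k, normalizedHaar X (B k) := by
    refine pos_iff_ne_zero.2 (Finset.prod_ne_zero_iff.2 fun k _ => ?_)
    exact ((hopen k).measure_pos _ ⟨y k, mem_interior_iff_mem_nhds.2 (hW k)⟩).ne'
  filter_upwards [(h B fun k => (hopen k).measurableSet.nullMeasurableSet).eventually
    (lt_mem_nhds hpos)] with n hn
  obtain ⟨x, hx⟩ := nonempty_of_measure_ne_zero hn.ne'
  rw [Set.mem_iInter] at hx
  exact ⟨x, hsub (a := fun k => χ k ((T k)^[n] x)) fun k _ => interior_subset (hx k)⟩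

theorem measurePreserving_iterate (hT : ∀ k, Function.Surjective (T k)) (k : Fin s) (n : ℕ) :
    MeasurePreserving (T k)^[n] (normalizedHaar X) (normalizedHaar X) :=
  MeasurePreserving.iterate (MonoidHom.measurePreserving (f := (T k).toMonoidHom)
    (map_continuous (T k)) (hT k) rfl) n

/-- Mixing for functions in place of sets. -/
def MixesFunctions (T : Fin s → (X →ₜ* X)) (f : Fin s → X → ℂ) : Prop :=
  Tendsto (fun n : ℕ => ∫ x, ∏ k, f k ((T k)^[n] x) ∂(normalizedHaar X)) atTop
    (𝓝 (∏ k, ∫ x, f k x ∂(normalizedHaar X)))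

/-- The limit in the definition of mixing for one varying function `g` and the other ones fixed. -/
def MixesAgainst (T : Fin s → (X →ₜ* X)) (k₀ : Fin s) (f : Fin s → X → ℂ) (g : X → ℂ) : Prop :=
  Tendsto (fun n : ℕ => ∫ x, g ((T k₀)^[n] x) * ∏ k ∈ Finset.univ.erase k₀, f k ((T k)^[n] x)
      ∂(normalizedHaar X)) atTop
    (𝓝 ((∫ x, g x ∂(normalizedHaar X)) *
      ∏ k ∈ Finset.univ.erase k₀, ∫ x, f k x ∂(normalizedHaar X)))

theorem mixesFunctions_update_iff (k₀ : Fin s) (f : Fin s → X → ℂ) (g : X → ℂ) :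
    MixesFunctions T (Function.update f k₀ g) ↔ MixesAgainst T k₀ f g := by
  unfold MixesFunctions MixesAgainst
  have h1 : ∀ (n : ℕ) (x : X), ∏ k, Function.update f k₀ g k ((T k)^[n] x) =
      g ((T k₀)^[n] x) * ∏ k ∈ Finset.univ.erase k₀, f k ((T k)^[n] x) := by
    intro n x
    rw [← Finset.mul_prod_erase _ _ (Finset.mem_univ k₀), Function.update_self]
    congr 1
    exact Finset.prod_congr rfl fun k hk => by
      rw [Function.update_of_ne (Finset.ne_of_mem_erase hk)]
  have h2 : ∏ k, ∫ x, Function.update f k₀ g k x ∂(normalizedHaar X) =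
      (∫ x, g x ∂(normalizedHaar X)) *
        ∏ k ∈ Finset.univ.erase k₀, ∫ x, f k x ∂(normalizedHaar X) := by
    rw [← Finset.mul_prod_erase _ _ (Finset.mem_univ k₀), Function.update_self]
    congr 1
    exact Finset.prod_congr rfl fun k hk => by
      rw [Function.update_of_ne (Finset.ne_of_mem_erase hk)]
  simp only [h1, h2]

section OneVariable

variable {f : Fin s → X → ℂ} (hf : ∀ k, AEStronglyMeasurable (f k) (normalizedHaar X))
  (hf1 : ∀ k x, ‖f k x‖ ≤ 1) (hT : ∀ k, Function.Surjective (T k)) (k₀ : Fin s)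
include hf hf1 hT

theorem integrable_iterate_mul_prod {g : X → ℂ} (hg : Integrable g (normalizedHaar X)) (n : ℕ) :
    Integrable (fun x => g ((T k₀)^[n] x) * ∏ k ∈ Finset.univ.erase k₀, f k ((T k)^[n] x))
      (normalizedHaar X) := by
  refine ((measurePreserving_iterate hT k₀ n).integrable_comp_of_integrable hg).mul_bdd (c := 1)
    ?_ (.of_forall fun x => ?_)
  · exact Finset.aestronglyMeasurable_fun_prod _ fun k _ =>
      (hf k).comp_measurePreserving (measurePreserving_iterate hT k n)
  · rw [norm_prod]
    exact Finset.prod_le_one (fun _ _ => norm_nonneg _) fun k _ => hf1 k _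

omit hf in
theorem norm_integral_iterate_mul_prod_le {g : X → ℂ} (hg : Integrable g (normalizedHaar X))
    (n : ℕ) :
    ‖∫ x, g ((T k₀)^[n] x) * ∏ k ∈ Finset.univ.erase k₀, f k ((T k)^[n] x) ∂(normalizedHaar X)‖ ≤
      ∫ x, ‖g x‖ ∂(normalizedHaar X) := by
  have hmp := measurePreserving_iterate hT k₀ n
  have h1 : ∫ x, ‖g ((T k₀)^[n] x)‖ ∂(normalizedHaar X) = ∫ x, ‖g x‖ ∂(normalizedHaar X) := by
    conv_rhs => rw [← hmp.map_eq]
    refine (integral_map (f := fun x => ‖g x‖) hmp.aemeasurable ?_).symm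
    rw [hmp.map_eq]
    exact hg.norm.aestronglyMeasurable
  rw [← h1]
  refine norm_integral_le_of_norm_le (hmp.integrable_comp_of_integrable hg).norm
    (.of_forall fun x => ?_)
  rw [norm_mul, norm_prod]
  exact mul_le_of_le_one_right (norm_nonneg _)
    (Finset.prod_le_one (fun _ _ => norm_nonneg _) fun k _ => hf1 k _)

omit hf hT in
theorem norm_prod_erase_integral_le :
    ‖∏ k ∈ Finset.univ.erase k₀, ∫ x, f k x ∂(normalizedHaar X)‖ ≤ 1 := by
  rw [norm_prod]
  refine Finset.prod_le_one (fun _ _ => norm_nonneg _) fun k _ => ?_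
  simpa using norm_integral_le_of_norm_le_const (μ := normalizedHaar X) (.of_forall (hf1 k))

theorem mixesAgainst_of_mem_span
    (h : ∀ χ, MixesAgainst T k₀ f (characterToContinuousMap X χ)) {t : C(X, ℂ)}
    (ht : t ∈ Submodule.span ℂ (Set.range (characterToContinuousMap X))) :
    MixesAgainst T k₀ f t := by
  have hint : ∀ t : C(X, ℂ), Integrable t (normalizedHaar X) := fun t =>
    t.continuous.integrable_of_hasCompactSupport (HasCompactSupport.of_compactSpace _)
  induction ht using Submodule.span_induction with
  | mem t ht => obtain ⟨χ, rfl⟩ := ht; exact h χ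
  | zero => simp [MixesAgainst]
  | add t t' _ _ ht ht' =>
    have := Tendsto.add ht ht'
    unfold MixesAgainst
    simp only [ContinuousMap.add_apply, add_mul]
    rw [integral_add (hint t) (hint t'), add_mul]
    refine this.congr fun n => ?_
    exact (integral_add (integrable_iterate_mul_prod hf hf1 hT k₀ (hint t) n)
      (integrable_iterate_mul_prod hf hf1 hT k₀ (hint t') n)).symm
  | smul c t _ ht =>
    have := Tendsto.const_mul c ht
    unfold MixesAgainst
    simp only [ContinuousMap.smul_apply, smul_eq_mul, mul_assoc, integral_const_mul]
    exact this

/-- The limit passes from characters to all integrable functions, because both sides are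
contractions for the `L¹` norm. -/
theorem mixesAgainst_of_integrable [T2Space X]
    (h : ∀ χ, MixesAgainst T k₀ f (characterToContinuousMap X χ)) {g : X → ℂ}
    (hg : Integrable g (normalizedHaar X)) : MixesAgainst T k₀ f g := by
  refine Metric.tendsto_atTop.2 fun ε hε => ?_
  obtain ⟨t, ht, hgt⟩ := exists_mem_span_characters_integral_norm_sub_le hg
    (show 0 < ε / 4 by positivity)
  have hti : Integrable t (normalizedHaar X) :=
    t.continuous.integrable_of_hasCompactSupport (HasCompactSupport.of_compactSpace _)
  obtain ⟨N, hN⟩ := Metric.tendsto_atTop.1 (mixesAgainst_of_mem_span hf hf1 hT k₀ h ht) (ε / 4)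
    (by positivity)
  refine ⟨N, fun n hn => ?_⟩
  have h1 := norm_integral_iterate_mul_prod_le hf1 hT k₀ (hg.sub hti) n
  simp only [Pi.sub_apply, sub_mul] at h1
  rw [integral_sub (integrable_iterate_mul_prod hf hf1 hT k₀ hg n)
    (integrable_iterate_mul_prod hf hf1 hT k₀ hti n)] at h1
  have h2 : ‖(∫ x, t x ∂(normalizedHaar X)) *
        ∏ k ∈ Finset.univ.erase k₀, ∫ x, f k x ∂(normalizedHaar X) -
      (∫ x, g x ∂(normalizedHaar X)) *
        ∏ k ∈ Finset.univ.erase k₀, ∫ x, f k x ∂(normalizedHaar X)‖ ≤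
      ∫ x, ‖g x - t x‖ ∂(normalizedHaar X) := by
    rw [← sub_mul, norm_mul, norm_sub_rev, ← integral_sub hg hti]
    exact (mul_le_of_le_one_right (norm_nonneg _) (norm_prod_erase_integral_le hf1 k₀)).trans
      (norm_integral_le_integral_norm _)
  have h3 := hN n hn
  rw [dist_eq_norm] at h3 ⊢
  calc _ ≤ _ := norm_sub_le_norm_sub_add_norm_sub _ _ _
    _ ≤ _ := add_le_add_right (norm_sub_le_norm_sub_add_norm_sub _ _ _) _
    _ < ε := by linarith [h1, h2, h3]

end OneVariable

theorem mixesFunctions_characters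
    (h : ∀ χ : Fin s → PontryaginDual X, χ ≠ 1 →
      ∀ᶠ n in atTop, ∃ x, ∏ k, χ k ((T k)^[n] x) ≠ 1) (χ : Fin s → PontryaginDual X) :
    MixesFunctions T fun k => characterToContinuousMap X (χ k) := by
  have hcoe : ∀ n x, ∏ k, characterToContinuousMap X (χ k) ((T k)^[n] x) =
      ((∏ k, χ k ((T k)^[n] x) : Circle) : ℂ) := by
    intro n x
    exact (map_prod Circle.coeHom _ _).symm
  unfold MixesFunctions
  simp only [hcoe]
  by_cases hχ : χ = 1
  · subst hχ
    simp
  · obtain ⟨k₀, hk₀⟩ := Function.ne_iff.1 hχ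
    have h0 : ∏ k, ∫ x, characterToContinuousMap X (χ k) x ∂(normalizedHaar X) = 0 := by
      refine Finset.prod_eq_zero (Finset.mem_univ k₀) (integral_character_eq_zero ?_)
      by_contra! hall
      exact hk₀ (PontryaginDual.ext hall)
    rw [h0]
    refine tendsto_const_nhds.congr' ?_
    filter_upwards [h χ hχ] with n hn
    obtain ⟨ψ, hψ⟩ := exists_pontryaginDual_eq_prod_iterate T χ n
    simp only [← hψ] at hn ⊢
    exact (integral_character_eq_zero hn).symm

/-- Starting from characters, the functions are replaced one at a time by arbitrary bounded
measurable functions. -/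
theorem mixesFunctions_of_characters [T2Space X] (hT : ∀ k, Function.Surjective (T k))
    (h : ∀ χ : Fin s → PontryaginDual X, MixesFunctions T fun k => characterToContinuousMap X (χ k))
    (S : Finset (Fin s)) {f : Fin s → X → ℂ}
    (hf : ∀ k, AEStronglyMeasurable (f k) (normalizedHaar X)) (hf1 : ∀ k x, ‖f k x‖ ≤ 1)
    (hS : ∀ k ∉ S, ∃ χ : PontryaginDual X, f k = characterToContinuousMap X χ) :
    MixesFunctions T f := by
  induction S using Finset.induction_on generalizing f with
  | empty =>
    choose χ hχ using fun k => hS k (Finset.notMem_empty k)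
    rw [show f = fun k => ⇑(characterToContinuousMap X (χ k)) from funext hχ]
    exact h χ
  | insert k₀ S hk₀ ih =>
    rw [← Function.update_eq_self k₀ f, mixesFunctions_update_iff]
    have hint : Integrable (f k₀) (normalizedHaar X) :=
      .of_bound (hf k₀) 1 (.of_forall (hf1 k₀))
    refine mixesAgainst_of_integrable hf hf1 hT k₀ (fun χ => ?_) hint
    rw [← mixesFunctions_update_iff]
    refine ih (fun k => ?_) (fun k x => ?_) (fun k hk => ?_)
    · rcases eq_or_ne k k₀ with rfl | hne
      · rw [Function.update_self]
        exact (characterToContinuousMap X χ).continuous.aestronglyMeasurable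
      · rw [Function.update_of_ne hne]
        exact hf k
    · rcases eq_or_ne k k₀ with rfl | hne
      · rw [Function.update_self]
        exact (Circle.norm_coe (χ x)).le
      · rw [Function.update_of_ne hne]
        exact hf1 k x
    · rcases eq_or_ne k k₀ with rfl | hne
      · exact ⟨χ, Function.update_self ..⟩
      · rw [Function.update_of_ne hne]
        exact hS k (by simp [hne, hk])

/-- Fourier-analytic characterization of mixing: every nontrivial relation between characters along
the orbits holds only finitely often. -/
theorem isMixing_iff_forall_characters [T2Space X] (hT : ∀ k, Function.Surjective (T k)) :
    IsMixing T ↔ ∀ χ : Fin s → PontryaginDual X, χ ≠ 1 →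
      ∀ᶠ n in atTop, ∃ x, ∏ k, χ k ((T k)^[n] x) ≠ 1 := by
  refine ⟨fun h χ hχ => h.eventually_exists_prod_iterate_ne_one hχ, fun h B hB => ?_⟩
  have key := mixesFunctions_of_characters hT (mixesFunctions_characters h) Finset.univ
    (f := fun k => (B k).indicator 1)
    (fun k => (aestronglyMeasurable_const (b := (1 : ℂ))).indicator₀ (hB k))
    (fun k x => (norm_indicator_le_norm_self _ _).trans (by simp)) (by simp)
  have h1 : ∀ n : ℕ, ∫ x, ∏ k, (B k).indicator (1 : X → ℂ) ((T k)^[n] x) ∂(normalizedHaar X) =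
      (((normalizedHaar X).real (⋂ k, (T k)^[n] ⁻¹' B k) : ℝ) : ℂ) := by
    intro n
    have h2 : ∀ x, ∏ k, (B k).indicator (1 : X → ℂ) ((T k)^[n] x) =
        (⋂ k, (T k)^[n] ⁻¹' B k).indicator (fun _ => (1 : ℂ)) x := by
      intro x
      by_cases hx : x ∈ ⋂ k, (T k)^[n] ⁻¹' B k
      · rw [Set.indicator_of_mem hx]
        refine Finset.prod_eq_one fun k _ => ?_
        rw [Set.indicator_of_mem (Set.mem_preimage.1 (Set.mem_iInter.1 hx k)), Pi.one_apply]
      · rw [Set.indicator_of_notMem hx]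
        obtain ⟨k, hk⟩ := not_forall.1 (fun h => hx (Set.mem_iInter.2 h))
        exact Finset.prod_eq_zero (Finset.mem_univ k) (Set.indicator_of_notMem
          (fun h => hk (Set.mem_preimage.2 h)) _)
    have hmeas : NullMeasurableSet (⋂ k, (T k)^[n] ⁻¹' B k) (normalizedHaar X) :=
      .iInter fun k =>
        (hB k).preimage (measurePreserving_iterate hT k n).quasiMeasurePreserving
    simp only [h2]
    rw [integral_indicator₀ hmeas]
    simp
  have h3 : ∀ k, ∫ x, (B k).indicator (1 : X → ℂ) x ∂(normalizedHaar X) =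
      (((normalizedHaar X).real (B k) : ℝ) : ℂ) := by
    intro k
    rw [integral_indicator₀ (hB k)]
    simp
  unfold MixesFunctions at key
  simp only [h1, h3] at key
  rw [← Complex.ofReal_prod] at key
  have key' := (Complex.continuous_re.tendsto _).comp key
  simp only [Function.comp_def, Complex.ofReal_re, Measure.real, ← ENNReal.toReal_prod] at key'
  exact (ENNReal.tendsto_toReal_iff (fun n => measure_ne_top _ _)
    (ENNReal.prod_ne_top fun k _ => measure_ne_top _ _)).1 key'

end Mixing

/-! ### Common eigenvalues and vanishing sums of orbits -/

section Eigenvectors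

variable {ι V : Type*} [Fintype ι] [AddCommGroup V] [Module ℚ V] {A : ι → Module.End ℚ V}

/-- The operator `v ↦ (A k (v k))_k` on families of vectors. -/
def diagonalEnd (A : ι → Module.End ℚ V) : Module.End ℚ (ι → V) :=
  LinearMap.pi fun k => A k ∘ₗ LinearMap.proj k

omit [Fintype ι] in
theorem diagonalEnd_pow_apply (n : ℕ) (v : ι → V) (k : ι) :
    (diagonalEnd A ^ n) v k = (A k ^ n) (v k) := by
  induction n with
  | zero => rfl
  | succ n ih =>
    rw [pow_succ', pow_succ', Module.End.mul_apply, Module.End.mul_apply, ← ih]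
    rfl

omit [Fintype ι] in
theorem isUnit_diagonalEnd (hA : ∀ k, IsUnit (A k)) : IsUnit (diagonalEnd A) := by
  simp only [Module.End.isUnit_iff] at hA ⊢
  refine ⟨fun v w h => funext fun k => (hA k).1 (congrFun h k), fun w => ?_⟩
  choose v hv using fun k => (hA k).2 (w k)
  exact ⟨v, funext hv⟩

theorem baseChange_sum_apply {κ M N : Type*} [AddCommGroup M] [Module ℚ M] [AddCommGroup N]
    [Module ℚ N] (S : Finset κ) (f : κ → M →ₗ[ℚ] N) (z : ℂ ⊗[ℚ] M) :
    (∑ k ∈ S, f k).baseChange ℂ z = ∑ k ∈ S, (f k).baseChange ℂ z := by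
  rw [← LinearMap.sum_apply]
  exact congrArg (fun g : ℂ ⊗[ℚ] M →ₗ[ℂ] ℂ ⊗[ℚ] N => g z)
    (map_sum (LinearMap.baseChangeHom ℚ ℂ M N) f S)

open Module.End in
/-- A nonzero family `u` with `∑ k, B k ^ n (u k) = 0` for all `n` lies in an invariant space of
such families. An eigenvector of the complexification of this space has as components eigenvectors
of the `B k` for one eigenvalue, with sum zero. -/
theorem exists_hasEigenvector_not_linearIndependent [FiniteDimensional ℚ V]
    {B : ι → Module.End ℚ V} {u : ι → V} (hu : u ≠ 0) (h : ∀ n : ℕ, ∑ k, (B k ^ n) (u k) = 0) :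
    ∃ (S : Finset ι) (μ : ℂ) (w : S → ℂ ⊗[ℚ] V),
      (∀ k : S, HasEigenvector ((B k).baseChange ℂ) μ (w k)) ∧ ¬ LinearIndependent ℚ w := by
  classical
  let W : Submodule ℚ (ι → V) :=
    ⨅ n : ℕ, LinearMap.ker ((∑ k, LinearMap.proj k : (ι → V) →ₗ[ℚ] V) ∘ₗ (diagonalEnd B ^ n))
  have hW : ∀ v, v ∈ W ↔ ∀ n : ℕ, ∑ k, (B k ^ n) (v k) = 0 := by
    intro v
    simp [W, Submodule.mem_iInf, diagonalEnd_pow_apply]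
  have hinv : ∀ v ∈ W, diagonalEnd B v ∈ W := by
    intro v hv
    rw [hW] at hv ⊢
    intro n
    rw [← hv (n + 1)]
    refine Finset.sum_congr rfl fun k _ => ?_
    rw [pow_succ]
    rfl
  let b : Module.End ℚ W := (diagonalEnd B).restrict hinv
  have : Nontrivial W := ⟨⟨u, (hW u).2 h⟩, 0, fun h0 => hu (congrArg Subtype.val h0)⟩
  obtain ⟨μ, hμ⟩ := Module.End.exists_eigenvalue (b.baseChange ℂ)
  obtain ⟨z, hz⟩ := hμ.exists_hasEigenvector
  let π : ι → W →ₗ[ℚ] V := fun k => LinearMap.proj k ∘ₗ W.subtype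
  let w : ι → ℂ ⊗[ℚ] V := fun k => (π k).baseChange ℂ z
  have hw : ∀ k, (B k).baseChange ℂ (w k) = μ • w k := by
    intro k
    have h1 : B k ∘ₗ π k = π k ∘ₗ b := rfl
    have h2 := congrArg (fun f : W →ₗ[ℚ] V => f.baseChange ℂ z) h1
    simp only [LinearMap.baseChange_comp, LinearMap.comp_apply, hz.apply_eq_smul, map_smul] at h2
    exact h2
  have hsum : ∑ k, w k = 0 := by
    have h1 : ∑ k, π k = 0 := by
      ext v
      simpa [π] using (hW v).1 v.2 0
    rw [← baseChange_sum_apply, h1, LinearMap.baseChange_zero, LinearMap.zero_apply]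
  -- The inclusion of `W` is the sum of the maps `Pi.single k ∘ π k`, so `z` is determined by `w`.
  have hne : ∃ k, w k ≠ 0 := by
    by_contra! hall
    have h1 : W.subtype = ∑ k, LinearMap.single ℚ (fun _ => V) k ∘ₗ π k := by
      ext v k
      simp [π, Finset.sum_apply, Pi.single_apply]
    have h2 : W.subtype.baseChange ℂ z = 0 := by
      rw [h1, baseChange_sum_apply]
      refine Finset.sum_eq_zero fun k _ => ?_
      rw [LinearMap.baseChange_comp, LinearMap.comp_apply,
        show (π k).baseChange ℂ z = 0 from hall k, map_zero]
    have h3 : Function.Injective (W.subtype.baseChange ℂ) :=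
      Module.Flat.lTensor_preserves_injective_linearMap _ W.injective_subtype
    exact hz.2 (h3 (h2.trans (map_zero _).symm))
  refine ⟨Finset.univ.filter fun k => w k ≠ 0, μ, fun k => w k, fun k => ?_, ?_⟩
  · exact hasEigenvector_iff.2 ⟨mem_eigenspace_iff.2 (hw k), (Finset.mem_filter.1 k.2).2⟩
  · rw [Fintype.not_linearIndependent_iff]
    obtain ⟨k, hk⟩ := hne
    refine ⟨fun _ => 1, ?_, ⟨k, Finset.mem_filter.2 ⟨Finset.mem_univ _, hk⟩⟩, one_ne_zero⟩
    simp only [one_smul]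
    rw [Finset.sum_coe_sort (Finset.univ.filter fun k => w k ≠ 0) w, Finset.sum_filter_ne_zero,
      hsum]

/-- Contraction of `ℂ ⊗ V` to `V` along a `ℚ`-linear functional on `ℂ`. -/
noncomputable def tensorContraction (V : Type*) [AddCommGroup V] [Module ℚ V] (f : ℂ →ₗ[ℚ] ℚ) :
    ℂ ⊗[ℚ] V →ₗ[ℚ] V :=
  (TensorProduct.lid ℚ V).toLinearMap ∘ₗ f.rTensor V

theorem tensorContraction_baseChange (f : ℂ →ₗ[ℚ] ℚ) (B : Module.End ℚ V) (z : ℂ ⊗[ℚ] V) :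
    tensorContraction V f (B.baseChange ℂ z) = B (tensorContraction V f z) := by
  induction z with
  | zero => simp
  | tmul c v => simp [tensorContraction]
  | add x y hx hy => simp only [map_add, hx, hy]

theorem exists_tensorContraction_ne_zero {z : ℂ ⊗[ℚ] V} (hz : z ≠ 0) :
    ∃ f, tensorContraction V f z ≠ 0 := by
  classical
  let b := Module.Free.chooseBasis ℚ ℂ
  let e := TensorProduct.equivFinsuppOfBasisLeft (N := V) b
  obtain ⟨i, hi⟩ := DFunLike.ne_iff.1 (e.map_ne_zero_iff.2 hz)
  refine ⟨b.coord i, ?_⟩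
  have h : ∀ z, e z i = tensorContraction V (b.coord i) z := by
    intro z
    induction z with
    | zero => simp
    | tmul c v => simp [tensorContraction, e]
    | add x y hx hy => simp only [map_add, Finsupp.add_apply, hx, hy]
  rwa [← h]

open Module.End in
/-- A `ℚ`-linear relation between eigenvectors for one eigenvalue gives a nonzero rational family
`u` with `∑ k, B k ^ n (u k) = 0` for all `n`: contract the relation along a functional on `ℂ`. -/
theorem exists_sum_pow_apply_eq_zero {B : ι → Module.End ℚ V} {S : Finset ι} {μ : ℂ}
    {w : S → ℂ ⊗[ℚ] V} (hw : ∀ k : S, HasEigenvector ((B k).baseChange ℂ) μ (w k))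
    (hdep : ¬ LinearIndependent ℚ w) :
    ∃ u : ι → V, u ≠ 0 ∧ ∀ n : ℕ, ∑ k, (B k ^ n) (u k) = 0 := by
  classical
  obtain ⟨c, hc, i, hi⟩ := Fintype.not_linearIndependent_iff.1 hdep
  obtain ⟨f, hf⟩ := exists_tensorContraction_ne_zero (hw i).2
  let u : ι → V := fun k => if hk : k ∈ S then c ⟨k, hk⟩ • tensorContraction V f (w ⟨k, hk⟩) else 0
  have huS : ∀ k : S, u k = c k • tensorContraction V f (w k) := fun k => dif_pos k.2
  refine ⟨u, fun h0 => smul_ne_zero hi hf ?_, fun n => ?_⟩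
  · rw [← huS, h0, Pi.zero_apply]
  have h1 : ∀ k : S, (B k ^ n) (u k) = tensorContraction V f (μ ^ n • c k • w k) := by
    intro k
    rw [huS, map_smul, ← tensorContraction_baseChange, LinearMap.baseChange_pow,
      (hw k).pow_apply, ← map_smul, smul_comm]
  have h2 : ∑ k, (B k ^ n) (u k) = ∑ k ∈ S, (B k ^ n) (u k) := by
    refine (Finset.sum_subset (Finset.subset_univ S) fun k _ hk => ?_).symm
    rw [show u k = 0 from dif_neg hk, map_zero]
  rw [h2, ← Finset.sum_coe_sort]
  simp only [h1]
  rw [← map_sum, ← Finset.smul_sum, hc, smul_zero, map_zero]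

/-- If `∑ k, A k ^ n (v k)` vanishes infinitely often, then some powers `A k ^ l` have `ℚ`-linearly
dependent eigenvectors for one eigenvalue. -/
theorem exists_hasEigenvector_not_linearIndependent_of_infinite [FiniteDimensional ℚ V]
    (hA : ∀ k, IsUnit (A k)) {v : ι → V} (hv : v ≠ 0)
    (hinf : {n : ℕ | ∑ k, (A k ^ n) (v k) = 0}.Infinite) :
    ∃ l : ℕ, 1 ≤ l ∧ ∃ (S : Finset ι) (μ : ℂ) (w : S → ℂ ⊗[ℚ] V),
      (∀ k : S, Module.End.HasEigenvector ((A k ^ l).baseChange ℂ) μ (w k)) ∧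
        ¬ LinearIndependent ℚ w := by
  let φ : (ι → V) →ₗ[ℚ] V := ∑ k, LinearMap.proj k
  have hφ : ∀ (n : ℕ), φ ((diagonalEnd A ^ n) v) = ∑ k, (A k ^ n) (v k) := by
    intro n
    simp [φ, diagonalEnd_pow_apply]
  simp only [← hφ] at hinf
  obtain ⟨a, l, hl, h⟩ := skolem_mahler_lech (isUnit_diagonalEnd hA) φ v hinf
  refine ⟨l, hl, exists_hasEigenvector_not_linearIndependent (B := fun k => A k ^ l)
    (u := (diagonalEnd A ^ a) v)
    (fun h0 => hv ?_) fun n => ?_⟩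
  · exact ((Module.End.isUnit_iff _).1 ((isUnit_diagonalEnd hA).pow a)).1
      (h0.trans (map_zero _).symm)
  · rw [← h n, hφ]
    refine Finset.sum_congr rfl fun k _ => ?_
    rw [diagonalEnd_pow_apply, ← pow_mul, ← Module.End.mul_apply, ← pow_add, add_comm]

end Eigenvectors

/-! ### The rational vector space spanned by the characters -/

section RatDual

variable {X : Type u} [CommGroup X] [TopologicalSpace X] [IsTopologicalGroup X]

/-- Evaluation of characters at a point. -/
noncomputable def characterEval {X : Type u} [CommGroup X] [TopologicalSpace X] (x : X) :
    PontryaginDual X →* Circle where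
  toFun ψ := ψ x
  map_one' := rfl
  map_mul' _ _ := rfl

theorem charMap_pow_apply (T : X →ₜ* X) (n : ℕ) (c : CharGroup X) (x : X) :
    ((charMap T ^ n) c).toMul x = c.toMul (T^[n] x) := by
  induction n generalizing x with
  | zero => rfl
  | succ n ih =>
    rw [pow_succ', Module.End.mul_apply, Function.iterate_succ_apply, ← ih]
    rfl

theorem ratDualMap_pow_one_tmul (T : X →ₜ* X) (n : ℕ) (c : CharGroup X) :
    (ratDualMap T ^ n) (1 ⊗ₜ[ℤ] c) = 1 ⊗ₜ[ℤ] (charMap T ^ n) c := by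
  rw [ratDualMap, ← LinearMap.baseChange_pow, LinearMap.baseChange_tmul]

omit [IsTopologicalGroup X] in
/-- The characters of a connected group form a torsion-free group: a torsion character takes values
in a finite set of roots of unity. -/
theorem charGroup_eq_zero_of_nsmul_eq_zero [ConnectedSpace X] {n : ℕ} (hn : n ≠ 0)
    {c : CharGroup X} (hc : n • c = 0) : c = 0 := by
  have hroot : ∀ x, (c.toMul x : Circle) ^ n = 1 := by
    intro x
    have h1 : c.toMul ^ n = 1 := congrArg Additive.toMul hc
    have h2 := congrArg (characterEval x) h1
    rwa [map_pow, map_one] at h2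
  have hfin : (Set.range c.toMul).Finite := by
    refine Set.Finite.of_finite_image (f := fun z : Circle => (z : ℂ)) ?_
      Circle.coe_injective.injOn
    refine (Polynomial.nthRoots n (1 : ℂ)).toFinset.finite_toSet.subset ?_
    rintro _ ⟨_, ⟨x, rfl⟩, rfl⟩
    simp only [Finset.mem_coe, Multiset.mem_toFinset,
      Polynomial.mem_nthRoots (Nat.pos_of_ne_zero hn)]
    exact_mod_cast congrArg (fun z : Circle => (z : ℂ)) (hroot x)
  have hsub : (Set.range c.toMul).Subsingleton :=
    hfin.countable.isTotallyDisconnected _ subset_rfl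
      (isPreconnected_range (map_continuous c.toMul))
  refine Additive.toMul.injective (PontryaginDual.ext fun x => ?_)
  exact (hsub ⟨x, rfl⟩ ⟨1, rfl⟩).trans (map_one c.toMul)

instance : IsLocalizedModule (nonZeroDivisors ℤ) (TensorProduct.mk ℤ ℚ (CharGroup X) 1) :=
  (isLocalizedModule_iff_isBaseChange (nonZeroDivisors ℤ) ℚ _).2
    (TensorProduct.isBaseChange ℤ (CharGroup X) ℚ)

omit [IsTopologicalGroup X] in
theorem one_tmul_charGroup_eq_zero_iff [ConnectedSpace X] {c : CharGroup X} :
    (1 : ℚ) ⊗ₜ[ℤ] c = 0 ↔ c = 0 := by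
  refine ⟨fun h => ?_, fun h => by rw [h, TensorProduct.tmul_zero]⟩
  obtain ⟨m, hm⟩ := (IsLocalizedModule.eq_zero_iff (nonZeroDivisors ℤ)
    (TensorProduct.mk ℤ ℚ (CharGroup X) 1)).1 h
  have hm0 : (m : ℤ) ≠ 0 := nonZeroDivisors.coe_ne_zero m
  refine charGroup_eq_zero_of_nsmul_eq_zero (Int.natAbs_ne_zero.2 hm0) ?_
  rcases Int.natAbs_eq (m : ℤ) with h1 | h1
  · rw [← natCast_zsmul, ← h1]
    exact hm
  · rw [← natCast_zsmul, show ((m : ℤ).natAbs : ℤ) = -m by omega, neg_smul, neg_eq_zero]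
    exact hm

theorem finiteDimensional_ratDual {d : ℕ} (hd : groupDim X = d) :
    FiniteDimensional ℚ (RatDual X) := by
  have h1 := IsLocalization.rank_eq (R := ℤ) (N := RatDual X) ℚ (nonZeroDivisors ℤ) le_rfl
  have h2 := IsLocalizedModule.rank_eq (nonZeroDivisors ℤ) le_rfl
    (TensorProduct.mk ℤ ℚ (CharGroup X) 1)
  refine Module.rank_lt_aleph0_iff.1 ?_
  rw [h1]
  refine lt_of_eq_of_lt ?_ (hd.trans_lt Cardinal.natCast_lt_aleph0)
  rw [groupDim, ← h2]
  -- The two `ℤ`-module structures on `ℚ ⊗ X̂` agree.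
  congr 1

theorem isUnit_ratDualMap [FiniteDimensional ℚ (RatDual X)] {T : X →ₜ* X}
    (hT : Function.Surjective T) : IsUnit (ratDualMap T) := by
  have h1 : Function.Injective (charMap T) := by
    intro c c' h
    refine Additive.toMul.injective (PontryaginDual.ext fun x => ?_)
    obtain ⟨y, rfl⟩ := hT x
    exact congrArg (fun a : CharGroup X => a.toMul y) h
  have h2 : Function.Injective (ratDualMap T) :=
    Module.Flat.lTensor_preserves_injective_linearMap _ h1
  rw [Module.End.isUnit_iff]
  exact ⟨h2, LinearMap.injective_iff_surjective.1 h2⟩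

theorem sum_ratDualMap_pow_eq_zero_iff [ConnectedSpace X] {s : ℕ} (T : Fin s → (X →ₜ* X))
    (χ : Fin s → PontryaginDual X) (n : ℕ) :
    ∑ k, (ratDualMap (T k) ^ n) (1 ⊗ₜ[ℤ] Additive.ofMul (χ k)) = 0 ↔
      ∀ x, ∏ k, χ k ((T k)^[n] x) = 1 := by
  simp only [ratDualMap_pow_one_tmul]
  rw [← TensorProduct.tmul_sum, one_tmul_charGroup_eq_zero_iff]
  have h1 : ∀ x, (∑ k, (charMap (T k) ^ n) (Additive.ofMul (χ k))).toMul x =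
      ∏ k, χ k ((T k)^[n] x) := by
    intro x
    rw [toMul_sum]
    refine (map_prod (characterEval x) _ _).trans (Finset.prod_congr rfl fun k _ => ?_)
    exact charMap_pow_apply (T k) n _ x
  simp only [← h1]
  exact ⟨fun h x => by rw [h]; rfl,
    fun h => Additive.toMul.injective (PontryaginDual.ext h)⟩

/-- Clearing denominators: a family in `ℚ ⊗ X̂` has a nonzero multiple consisting of characters. -/
theorem exists_nsmul_eq_one_tmul {s : ℕ} (u : Fin s → RatDual X) :
    ∃ m : ℤ, m ≠ 0 ∧ ∃ χ : Fin s → PontryaginDual X,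
      ∀ k, (1 : ℚ) ⊗ₜ[ℤ] Additive.ofMul (χ k) = m • u k := by
  obtain ⟨m, hm⟩ := IsLocalizedModule.exist_integer_multiples (nonZeroDivisors ℤ)
    (TensorProduct.mk ℤ ℚ (CharGroup X) 1) Finset.univ u
  choose c hc using fun k => hm k (Finset.mem_univ k)
  exact ⟨m, nonZeroDivisors.coe_ne_zero m, fun k => (c k).toMul, hc⟩

end RatDual

theorem mainTheorem1 {X : Type u} [CommGroup X] [TopologicalSpace X] [IsTopologicalGroup X]
    [CompactSpace X] [T2Space X] [ConnectedSpace X] [MeasurableSpace X] [BorelSpace X]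
    (d : ℕ) (hd : groupDim X = d)
    {s : ℕ} (T : Fin s → (X →ₜ* X)) (hT : ∀ k, Function.Surjective (T k)) :
    IsMixing T ↔
      ∀ l : ℕ, 1 ≤ l → ∀ (S : Finset (Fin s)) (μ : ℂ),
        ¬ ∃ w : S → ℂ ⊗[ℚ] RatDual X,
          (∀ k : S, Module.End.HasEigenvector ((ratDualMap (T k) ^ l).baseChange ℂ) μ (w k)) ∧
            ¬ LinearIndependent ℚ w := by
  have : FiniteDimensional ℚ (RatDual X) := finiteDimensional_ratDual hd
  rw [isMixing_iff_forall_characters hT]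
  constructor
  · rintro h l hl S μ ⟨w, hw, hdep⟩
    obtain ⟨u, hu, hsum⟩ := exists_sum_pow_apply_eq_zero
      (B := fun k => ratDualMap (T k) ^ l) hw hdep
    obtain ⟨m, hm, χ, hχ⟩ := exists_nsmul_eq_one_tmul u
    have hχ1 : χ ≠ 1 := by
      rintro rfl
      refine hu (funext fun k => ?_)
      have h1 := hχ k
      rw [Pi.one_apply, ofMul_one, TensorProduct.tmul_zero, ← Int.cast_smul_eq_zsmul ℚ] at h1
      exact (smul_eq_zero.1 h1.symm).resolve_left (Int.cast_ne_zero.2 hm)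
    obtain ⟨N, hN⟩ := eventually_atTop.1 (h χ hχ1)
    obtain ⟨x, hx⟩ := hN (l * N) (Nat.le_mul_of_pos_left N hl)
    refine hx ((sum_ratDualMap_pow_eq_zero_iff T χ (l * N)).1 ?_ x)
    simp only [hχ, map_zsmul, pow_mul, ← Finset.smul_sum]
    rw [hsum N, smul_zero]
  · intro h χ hχ
    by_contra hfreq
    rw [Filter.not_eventually] at hfreq
    refine absurd (exists_hasEigenvector_not_linearIndependent_of_infinite
      (A := fun k => ratDualMap (T k)) (v := fun k => 1 ⊗ₜ[ℤ] Additive.ofMul (χ k))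
      (fun k => isUnit_ratDualMap (hT k)) (fun h0 => hχ ?_) ?_) ?_
    · exact funext fun k => Additive.ofMul.injective
        (one_tmul_charGroup_eq_zero_iff.1 (congrFun h0 k))
    · simp only [sum_ratDualMap_pow_eq_zero_iff]
      rw [← Nat.frequently_atTop_iff_infinite]
      simpa only [not_exists, not_not] using hfreq
    · rintro ⟨l, hl, S, μ, w, hw, hdep⟩
      exact h l hl S μ ⟨w, hw, hdep⟩
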